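/- All Lie algebras are real and finite dimensional. A complex product structure on a Lie algebra $\mathfrak g$ is a pair $\{J,E\}$ of linear endomorphisms of $\mathfrak g$ with $J^2=-\mathrm{Id}$, $E^2=\mathrm{Id}$, $E\neq\pm\mathrm{Id}$, $JE=-EJ$ such that, for all $x,y\in\mathfrak g$, $$J[x,y]=[Jx,y]+[x,Jy]+J[Jx,Jy],\qquad E[x,y]=[Ex,y]+[x,Ey]-E[Ex,Ey].$$ The eigenspaces $\mathfrak g_+$ and $\mathfrak g_-$ of $E$ for the eigenvalues $+1$ and $-1$ are then Lie subalgebras of $\mathfrak g$. A left-symmetric algebra (LSA) structure on a Lie algebra $\mathfrak h$ is a bilinear product on $\mathfrak h$ with $x\cdot(y\cdot z)-(x\cdot y)\cdot z=y\cdot(x\cdot z)-(y\cdot x)\cdot z$ and $[x,y]=x\cdot y-y\cdot x$; writing $\nabla_xy=x\cdot y$, this is the same as a flat torsion-free connection on $\mathfrak h$. It is called complete if the corresponding left-invariant connection on the simply connected Lie group with Lie algebra $\mathfrak h$ (the one with $\nabla_{X_u}X_v=X_{u\cdot v}$, where $X_u$ is the left-invariant vector field defined by $u\in\mathfrak h$)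 is geodesically complete, i.e. every tangent vector is the initial velocity of a geodesic defined on all of $\mathbb R$. **Theorem.** Let $\mathfrak g$ be a nilpotent Lie algebra with a complex product structure $\{J,E\}$. There is a unique bilinear map $\nabla:\mathfrak g\times\mathfrak g\to\mathfrak g$ such that, for all $x,y\in\mathfrak g$, $\nabla_xy-\nabla_yx=[x,y]$, $\nabla_xJy=J\nabla_xy$ and $\nabla_xEy=E\nabla_xy$. It restricts to connections $\nabla^+$ on $\mathfrak g_+$ and $\nabla^-$ on $\mathfrak g_-$, and both $\nabla^+$ and $\nabla^-$ are complete LSA structures. -/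

import Mathlib

open scoped Manifold ContDiff

universe w u

/-! ### Complex product structures on a Lie algebra -/

section Algebra

variable {g : Type*} [LieRing g] [LieAlgebra ℝ g]

/-- A complex structure on a real Lie algebra: `J² = -Id` together with integrability. -/
structure IsComplexStructure (J : g →ₗ[ℝ] g) : Prop where
  sq : ∀ x, J (J x) = -x
  integrable : ∀ x y, J ⁅x, y⁆ = ⁅J x, y⁆ + ⁅x, J y⁆ + J ⁅J x, J y⁆

/-- A product structure on a real Lie algebra: `E² = Id`, `E ≠ ±Id`, together with
integrability. -/
structure IsProductStructure (E : g →ₗ[ℝ] g) : Prop where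
  sq : ∀ x, E (E x) = x
  ne_id : E ≠ LinearMap.id
  ne_neg_id : E ≠ -LinearMap.id
  integrable : ∀ x y, E ⁅x, y⁆ = ⁅E x, y⁆ + ⁅x, E y⁆ - E ⁅E x, E y⁆

/-- A complex product structure `{J, E}`: a complex structure and a product structure which
anticommute. -/
structure IsComplexProductStructure (J E : g →ₗ[ℝ] g) : Prop where
  complex : IsComplexStructure J
  product : IsProductStructure E
  anticomm : ∀ x, J (E x) = -E (J x)

/-- The subalgebra `g₊`, the `(+1)`-eigenspace of a product structure. -/
def IsProductStructure.plus {E : g →ₗ[ℝ] g} (hE : IsProductStructure E) : LieSubalgebra ℝ g where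
  carrier := {x | E x = x}
  add_mem' := by
    intro x y hx hy
    change E x = x at hx
    change E y = y at hy
    change E (x + y) = x + y
    rw [map_add, hx, hy]
  zero_mem' := map_zero E
  smul_mem' := by
    intro c x hx
    change E x = x at hx
    change E (c • x) = c • x
    rw [map_smul, hx]
  lie_mem' := by
    intro x y hx hy
    change E x = x at hx
    change E y = y at hy
    have h := hE.integrable x y
    rw [hx, hy] at h
    have h2 : (2 : ℝ) • E ⁅x, y⁆ = (2 : ℝ) • ⁅x, y⁆ := by
      rw [two_smul, two_smul]
      exact eq_sub_iff_add_eq.mp h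
    exact smul_right_injective g (two_ne_zero : (2 : ℝ) ≠ 0) h2

/-- The subalgebra `g₋`, the `(-1)`-eigenspace of a product structure. -/
def IsProductStructure.minus {E : g →ₗ[ℝ] g} (hE : IsProductStructure E) : LieSubalgebra ℝ g where
  carrier := {x | E x = -x}
  add_mem' := by
    intro x y hx hy
    change E x = -x at hx
    change E y = -y at hy
    change E (x + y) = -(x + y)
    rw [map_add, hx, hy, neg_add]
  zero_mem' := by simp
  smul_mem' := by
    intro c x hx
    change E x = -x at hx
    change E (c • x) = -(c • x)
    rw [map_smul, hx, smul_neg]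
  lie_mem' := by
    intro x y hx hy
    change E x = -x at hx
    change E y = -y at hy
    change E ⁅x, y⁆ = -⁅x, y⁆
    have h := hE.integrable x y
    rw [hx, hy] at h
    simp only [neg_lie, lie_neg, neg_neg] at h
    have h2 : (2 : ℝ) • E ⁅x, y⁆ = (2 : ℝ) • -⁅x, y⁆ := by
      rw [two_smul, two_smul]
      exact eq_sub_iff_add_eq.mp h
    exact smul_right_injective g (two_ne_zero : (2 : ℝ) ≠ 0) h2

/-- `D x y = ∇_x y` is a torsion-free connection on the Lie algebra for which both `J` and `E` are
parallel. -/
structure IsCPConnection (J E : g →ₗ[ℝ] g) (D : g →ₗ[ℝ] g →ₗ[ℝ] g) : Prop where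
  torsionFree : ∀ x y, D x y - D y x = ⁅x, y⁆
  parallel_J : ∀ x y, D x (J y) = J (D x y)
  parallel_E : ∀ x y, D x (E y) = E (D x y)

/-- The connection induced on a totally geodesic subalgebra. -/
def inducedConnection (S : LieSubalgebra ℝ g) (D : g →ₗ[ℝ] g →ₗ[ℝ] g)
    (hS : ∀ x ∈ S, ∀ y ∈ S, D x y ∈ S) : S →ₗ[ℝ] S →ₗ[ℝ] S :=
  LinearMap.mk₂ ℝ (fun x y => ⟨D x y, hS x x.2 y y.2⟩)
    (fun x x' y => Subtype.ext (by simp))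
    (fun c x y => Subtype.ext (by simp))
    (fun x y y' => Subtype.ext (by simp))
    (fun c x y => Subtype.ext (by simp))

theorem IsCPConnection.mem_plus {J E : g →ₗ[ℝ] g} {D : g →ₗ[ℝ] g →ₗ[ℝ] g}
    (hD : IsCPConnection J E D) (hE : IsProductStructure E) :
    ∀ x ∈ hE.plus, ∀ y ∈ hE.plus, D x y ∈ hE.plus := by
  intro x _ y hy
  change E y = y at hy
  change E (D x y) = D x y
  rw [← hD.parallel_E, hy]

theorem IsCPConnection.mem_minus {J E : g →ₗ[ℝ] g} {D : g →ₗ[ℝ] g →ₗ[ℝ] g}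
    (hD : IsCPConnection J E D) (hE : IsProductStructure E) :
    ∀ x ∈ hE.minus, ∀ y ∈ hE.minus, D x y ∈ hE.minus := by
  intro x _ y hy
  change E y = -y at hy
  change E (D x y) = -D x y
  rw [← hD.parallel_E, hy, map_neg]

/-- The connection `∇⁺` induced on `g₊`. -/
def IsCPConnection.plus {J E : g →ₗ[ℝ] g} {D : g →ₗ[ℝ] g →ₗ[ℝ] g}
    (hD : IsCPConnection J E D) (hE : IsProductStructure E) :
    hE.plus →ₗ[ℝ] hE.plus →ₗ[ℝ] hE.plus :=
  inducedConnection hE.plus D (hD.mem_plus hE)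

/-- The connection `∇⁻` induced on `g₋`. -/
def IsCPConnection.minus {J E : g →ₗ[ℝ] g} {D : g →ₗ[ℝ] g →ₗ[ℝ] g}
    (hD : IsCPConnection J E D) (hE : IsProductStructure E) :
    hE.minus →ₗ[ℝ] hE.minus →ₗ[ℝ] hE.minus :=
  inducedConnection hE.minus D (hD.mem_minus hE)

/-- A left-symmetric algebra structure `x · y = L x y` on a Lie algebra, equivalently a flat
torsion-free connection `∇_x y = L x y`. -/
structure IsLSA (L : g →ₗ[ℝ] g →ₗ[ℝ] g) : Prop where
  left_symm : ∀ x y z, L x (L y z) - L (L x y) z = L y (L x z) - L (L y x) z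
  torsionFree : ∀ x y, L x y - L y x = ⁅x, y⁆

end Algebra

/-! ### Left-invariant connections on a Lie group and their geodesics -/

noncomputable section LieGroups

variable {V : Type*} [NormedAddCommGroup V] [NormedSpace ℝ V]
  {H : Type*} [TopologicalSpace H] {I : ModelWithCorners ℝ V H}
  {G : Type*} [TopologicalSpace G] [ChartedSpace H G] [Group G]

/-- A smooth real Lie group has the regularity under which its Lie algebra is defined. -/
instance instLieGroupMinSmoothnessThree [LieGroup I ∞ G] :
    LieGroup I (minSmoothness ℝ 3) G := by
  rw [minSmoothness_of_isRCLikeNormedField]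
  infer_instance

/-- The left Maurer-Cartan form: a tangent vector `w` at `a` is sent to the element `d(a⁻¹ ·) w`
of the Lie algebra, so that `w` is the value at `a` of the left-invariant vector field of this
element. -/
def maurerCartan (a : G) : TangentSpace I a →L[ℝ] GroupLieAlgebra I G :=
  ((mfderiv I I (fun b : G => a⁻¹ * b) a : V →L[ℝ] V) : V →L[ℝ] V)

/-- The differential at `1` of the left translation by `a`. -/
def leftTranslation (a : G) : GroupLieAlgebra I G →L[ℝ] TangentSpace I a :=
  (mfderiv I I (fun b : G => a * b) (1 : G) : V →L[ℝ] V)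

theorem leftTranslation_apply (a : G) (v : GroupLieAlgebra I G) :
    leftTranslation a v = mulInvariantVectorField v a := rfl

/-- A vector field on the group in the left-invariant trivialization, as a function with values
in the model vector space of the Lie algebra. -/
def leftCoord (σ : ∀ a : G, TangentSpace I a) : G → V :=
  fun b => maurerCartan b (σ b)

/-- The differential of `leftCoord σ`, with values in the Lie algebra. -/
def leftCoordDeriv (σ : ∀ a : G, TangentSpace I a) (a : G) :
    TangentSpace I a →L[ℝ] GroupLieAlgebra I G :=
  mvfderiv I (leftCoord σ) a

instance instFiniteDimensionalTangentSpaceModel [FiniteDimensional ℝ V] (a : G) :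
    FiniteDimensional ℝ (TangentSpace I a) :=
  inferInstanceAs (FiniteDimensional ℝ V)

instance instT2SpaceTangentSpaceModel (a : G) : T2Space (TangentSpace I a) :=
  inferInstanceAs (T2Space V)

variable [LieGroup I ∞ G]

theorem leftTranslation_maurerCartan (a : G) (w : TangentSpace I a) :
    leftTranslation a (maurerCartan a w) = w := by
  have hM : (∞ : ℕ∞ω) ≠ 0 := by simp
  have A : mfderiv I I ((fun x : G => a * x) ∘ (fun x => a⁻¹ * x)) a =
      ContinuousLinearMap.id ℝ (TangentSpace I a) := by
    have : (fun x : G => a * x) ∘ (fun x => a⁻¹ * x) = id := by ext x; simp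
    rw [this, mfderiv_id]
  rw [mfderiv_comp (I' := I) _ ((contMDiff_mul_left (n := ∞)).contMDiffAt.mdifferentiableAt hM)
    ((contMDiff_mul_left (n := ∞)).contMDiffAt.mdifferentiableAt hM), inv_mul_cancel] at A
  exact DFunLike.congr_fun A w

theorem maurerCartan_leftTranslation (a : G) (v : GroupLieAlgebra I G) :
    maurerCartan a (leftTranslation a v) = v := by
  have hM : (∞ : ℕ∞ω) ≠ 0 := by simp
  have A : mfderiv I I ((fun x : G => a⁻¹ * x) ∘ (fun x => a * x)) 1 =
      ContinuousLinearMap.id ℝ (TangentSpace I (1 : G)) := by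
    have : (fun x : G => a⁻¹ * x) ∘ (fun x => a * x) = id := by ext x; simp
    rw [this, mfderiv_id]
  rw [mfderiv_comp (I' := I) _ ((contMDiff_mul_left (n := ∞)).contMDiffAt.mdifferentiableAt hM)
    ((contMDiff_mul_left (n := ∞)).contMDiffAt.mdifferentiableAt hM), mul_one] at A
  exact DFunLike.congr_fun A v

theorem trivializationAt_one_snd {c : G} (hc : c = 1) (w : V) :
    (trivializationAt V (TangentSpace I) (1 : G)
      (Bundle.TotalSpace.mk' V c (w : TangentSpace I c))).2 = w := by
  subst hc
  have h2 := (tangentBundleCore I G).coordChange_self (achart H (1 : G)) 1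
    (mem_chart_source H (1 : G)) w
  exact (congrArg Prod.snd
    (TangentBundle.trivializationAt_apply (I := I) (1 : G) ⟨1, w⟩)).trans h2

theorem mdifferentiableAt_leftCoord {σ : ∀ a : G, TangentSpace I a} {a : G}
    (hσ : MDiffAt (T% σ) a) : MDifferentiableAt I 𝓘(ℝ, V) (leftCoord σ) a := by
  have hM : (∞ : ℕ∞ω) ≠ 0 := by simp
  let fg : G → TangentBundle I G := fun b => Bundle.TotalSpace.mk' V b⁻¹ 0
  have sfg : MDifferentiableAt I I.tangent fg a := by
    have h0 : ContMDiff I I.tangent ∞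
        (fun b : G => (Bundle.TotalSpace.mk' V b 0 : TangentBundle I G)) :=
      Bundle.contMDiff_zeroSection ℝ (TangentSpace I : G → Type _)
    exact ((h0.comp (contMDiff_inv I ∞)).mdifferentiable hM) a
  let S : G → TangentBundle I G := fun b =>
    tangentMap (I.prod I) I (fun p : G × G => p.1 * p.2)
      ((equivTangentBundleProd I G I G).symm (fg b, Bundle.TotalSpace.mk' V b (σ b)))
  have hS : MDifferentiableAt I I.tangent S a := by
    have S₂ : ContMDiff (I.tangent.prod I.tangent) (I.prod I).tangent 1
      (equivTangentBundleProd I G I G).symm := contMDiff_equivTangentBundleProd_symm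
    have S₃ : ContMDiff (I.prod I).tangent I.tangent 1
        (tangentMap (I.prod I) I (fun p : G × G => p.1 * p.2)) := by
      apply ContMDiff.contMDiff_tangentMap (n := ∞) (contMDiff_mul I ∞)
      norm_cast
    have h23 := ((S₃.comp S₂).mdifferentiable (by simp)) (fg a, Bundle.TotalSpace.mk' V a (σ a))
    exact h23.comp a (sfg.prodMk hσ)
  have key : ∀ b, S b = Bundle.TotalSpace.mk' V (b⁻¹ * b) (leftCoord σ b : V) := by
    intro b
    have hm : MDifferentiableAt (I.prod I) I (fun p : G × G => p.1 * p.2) (b⁻¹, b) :=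
      (contMDiff_mul I ∞).mdifferentiable hM _
    let w : V := σ b
    let v : V × V := (0, w)
    have h := mfderiv_prod_eq_add_apply (v := v) hm
    refine congrArg (Bundle.TotalSpace.mk' V (b⁻¹ * b)) (h.trans ?_)
    change mfderiv I I (fun z : G => z * b) b⁻¹ 0 + _ = _
    rw [map_zero, zero_add]
    rfl
  rw [mdifferentiableAt_totalSpace] at hS
  have h2 := hS.2
  have h1 : (S a).proj = 1 := by rw [key]; simp
  rw [h1] at h2
  refine h2.congr_of_eventuallyEq (Filter.Eventually.of_forall fun b => ?_)
  simp only [key]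
  exact (trivializationAt_one_snd (inv_mul_cancel b) _).symm

variable [FiniteDimensional ℝ V]

/-- The left-invariant connection on the Lie group determined by a bilinear product `B` on its Lie
algebra: if `X_v` is the left-invariant vector field of `v`, then `∇_{X_u} X_v = X_{B u v}`
(see `leftInvariantConnection_mulInvariantVectorField`). In the left-invariant trivialization,
`∇_w σ = dσ(w) + B w σ`. -/
def leftInvariantConnection
    (B : GroupLieAlgebra I G →ₗ[ℝ] GroupLieAlgebra I G →ₗ[ℝ] GroupLieAlgebra I G) :
    CovariantDerivative I V (fun a : G => TangentSpace I a) where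
  toFun σ a :=
    (leftTranslation a : GroupLieAlgebra I G →L[ℝ] TangentSpace I a).comp
      (leftCoordDeriv σ a +
        (LinearMap.toContinuousLinearMap
          (B.flip (maurerCartan a (σ a)))).comp (maurerCartan a))
  isCovariantDerivativeOnUniv := by
    constructor
    · intro σ σ' a hσ hσ' _
      have h : leftCoord (σ + σ') = leftCoord σ + leftCoord σ' := by
        funext b; exact map_add (maurerCartan b) _ _
      have h1 : leftCoordDeriv (σ + σ') a = leftCoordDeriv σ a + leftCoordDeriv σ' a := by
        unfold leftCoordDeriv
        rw [h, mvfderiv_add (mdifferentiableAt_leftCoord hσ) (mdifferentiableAt_leftCoord hσ')]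
        rfl
      ext w
      simp [h1]
      abel
    · intro σ f a hσ hf _
      have h : leftCoord (f • σ) = f • leftCoord σ := by
        funext b; exact map_smul (maurerCartan b) _ _
      have h1 : leftCoordDeriv (f • σ) a = f a • leftCoordDeriv σ a +
          (mvfderiv I f a).smulRight (maurerCartan a (σ a)) := by
        unfold leftCoordDeriv
        rw [h, mvfderiv_smul hf (mdifferentiableAt_leftCoord hσ)]
        rfl
      ext w
      simp [h1, leftTranslation_maurerCartan]
      abel

/-- The defining property of the left-invariant connection. -/
theorem leftInvariantConnection_mulInvariantVectorField
    (B : GroupLieAlgebra I G →ₗ[ℝ] GroupLieAlgebra I G →ₗ[ℝ] GroupLieAlgebra I G)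
    (u v : GroupLieAlgebra I G) (a : G) :
    leftInvariantConnection B (mulInvariantVectorField v) a (mulInvariantVectorField u a) =
      mulInvariantVectorField (B u v) a := by
  let v' : V := v
  have h : leftCoord (I := I) (G := G) (mulInvariantVectorField v) = fun _ => v' := by
    funext b
    exact maurerCartan_leftTranslation b v
  have h1 : leftCoordDeriv (I := I) (G := G) (mulInvariantVectorField v) a = 0 := by
    unfold leftCoordDeriv
    rw [h, mvfderiv_const]
    rfl
  simp [leftInvariantConnection, h1, ← leftTranslation_apply, maurerCartan_leftTranslation]

end LieGroups

/-! ### Geodesics -/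

noncomputable section Geodesics

variable {V : Type*} [NormedAddCommGroup V] [NormedSpace ℝ V]
  {H : Type*} [TopologicalSpace H] {I : ModelWithCorners ℝ V H}
  {G : Type*} [TopologicalSpace G] [ChartedSpace H G] [Group G]

/-- The velocity vector of a curve. -/
def velocity (γ : ℝ → G) (t : ℝ) : TangentSpace I (γ t) :=
  mfderiv 𝓘(ℝ, ℝ) I γ t (1 : ℝ)

/-- A vector field along a curve in the left-invariant trivialization. -/
def leftCoordAlong (γ : ℝ → G) (W : ∀ t, TangentSpace I (γ t)) : ℝ → V :=
  fun t => maurerCartan (γ t) (W t)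

variable [LieGroup I ∞ G]

/-- The covariant derivative `DW/dt` along a curve `γ` of a vector field `W` along `γ`, computed in
the global frame of left-invariant vector fields: if `(X_i)` is such a frame and
`W = ∑ fᵢ • (X_i ∘ γ)`, then `DW/dt = ∑ fᵢ' • (X_i ∘ γ) + ∑ fᵢ • ∇_{γ'} X_i`. -/
def covDerivAlong (cov : CovariantDerivative I V (fun a : G => TangentSpace I a))
    (γ : ℝ → G) (W : ∀ t, TangentSpace I (γ t)) (t : ℝ) : TangentSpace I (γ t) :=
  leftTranslation (γ t) (deriv (leftCoordAlong γ W) t : V) +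
    cov (mulInvariantVectorField (maurerCartan (γ t) (W t))) (γ t) (velocity γ t)

/-- A curve defined on the whole real line is a geodesic if it is twice differentiable and its
velocity field is parallel along it. -/
structure IsGeodesic (cov : CovariantDerivative I V (fun a : G => TangentSpace I a))
    (γ : ℝ → G) : Prop where
  mdifferentiable : MDifferentiable 𝓘(ℝ, ℝ) I γ
  differentiable_velocity : Differentiable ℝ (leftCoordAlong (I := I) γ (velocity γ))
  parallel : ∀ t, covDerivAlong cov γ (velocity γ) t = 0

/-- Geodesic completeness: every tangent vector is the initial velocity of a geodesic defined on
the whole real line. -/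
def IsGeodesicallyComplete
    (cov : CovariantDerivative I V (fun a : G => TangentSpace I a)) : Prop :=
  ∀ p : TangentBundle I G, ∃ γ : ℝ → G, IsGeodesic cov γ ∧
    (⟨γ 0, velocity γ 0⟩ : TangentBundle I G) = p

end Geodesics

/-! ### Completeness of a left-symmetric algebra structure -/

/-- Transport of a bilinear product along an isomorphism of Lie algebras. -/
def transportProduct {k h : Type*} [LieRing k] [LieAlgebra ℝ k] [LieRing h] [LieAlgebra ℝ h]
    (φ : k ≃ₗ⁅ℝ⁆ h) (L : h →ₗ[ℝ] h →ₗ[ℝ] h) : k →ₗ[ℝ] k →ₗ[ℝ] k :=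
  LinearMap.mk₂ ℝ (fun x y => φ.symm (L (φ x) (φ y)))
    (fun x x' y => by simp)
    (fun c x y => by simp)
    (fun x y y' => by simp)
    (fun c x y => by simp)

/-- A product `x · y = L x y` on a finite-dimensional real Lie algebra `h` is complete if the
corresponding left-invariant connection on the simply connected Lie group with Lie algebra `h` is
geodesically complete. That group, with the identification `φ` of its Lie algebra with `h`, is
unique up to isomorphism; all its models are considered. -/
def IsCompleteLSA {h : Type u} [LieRing h] [LieAlgebra ℝ h]
    (L : h →ₗ[ℝ] h →ₗ[ℝ] h) : Prop :=
  ∀ (n : ℕ) (G : Type w) [TopologicalSpace G] [ChartedSpace (EuclideanSpace ℝ (Fin n)) G]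
    [Group G] [LieGroup (𝓡 n) ∞ G] [SimplyConnectedSpace G]
    (φ : GroupLieAlgebra (𝓡 n) G ≃ₗ⁅ℝ⁆ h),
    IsGeodesicallyComplete (leftInvariantConnection (transportProduct φ L))

/-!
On `g₊ × g₋` and `g₋ × g₊` the two parallelism conditions force `∇` to be the Bott connection of
the splitting `g = g₊ ⊕ g₋`, and `∇ J = 0` then determines the rest. For `S = g₊` or `S = g₋` the
map `J` identifies `S` with the `S`-module `g ⧸ S`, and the induced connection with the action
of `S` on it. So `L_x y = x · y` is a representation, which is left symmetry, and for nilpotent `g`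
each `L_x` is nilpotent; as `ad x` is nilpotent too, the right multiplications `R_x = L_x - ad x`
have trace zero. By left symmetry `tr (R_v ^ k R_x) = 0` for all `k`, hence every `R_v` is
nilpotent.

The left logarithmic derivative `u = γ⁻¹ γ'` of a geodesic satisfies `u' = -u · u`. As `R_v` is
nilpotent, `y t = (1 + t R_v)⁻¹ v` is defined for all `t`, and if `C` solves the linear equation
`C' = -C L_y` with `C 0 = 1`, then `u t = C t v` is the global solution starting at `v`. Finally the
equation `γ⁻¹ γ' = u` has global solutions on every Lie group, because left invariance makes the
time of existence uniform.
-/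

/-! ### Traces and nilpotency -/

section TraceNilpotent

open Polynomial

theorem trace_aeval_mul_X_eq_zero {R V : Type*} [CommRing R] [AddCommGroup V] [Module R V]
    {f : Module.End R V} (hf : ∀ k : ℕ, LinearMap.trace R V (f ^ (k + 1)) = 0) (q : R[X]) :
    LinearMap.trace R V (aeval f (q * X)) = 0 := by
  induction q using Polynomial.induction_on' with
  | add p q hp hq => rw [add_mul, map_add, map_add, hp, hq, add_zero]
  | monomial n c => rw [monomial_mul_X, aeval_monomial, ← Algebra.smul_def, map_smul, hf, smul_zero]

theorem isIdempotentElem_aeval_of_mul_eq_zero {R A : Type*} [CommRing R] [Ring A] [Algebra R A]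
    {a : A} {p q : R[X]} (hpq : p + q = 1) (h : aeval a (p * q) = 0) :
    IsIdempotentElem (aeval a q) := by
  have hp : aeval a p = 1 - aeval a q := by rw [eq_sub_iff_add_eq, ← map_add, hpq, map_one]
  rw [map_mul, hp, sub_mul, one_mul, sub_eq_zero] at h
  exact h.symm

/- Write the characteristic polynomial as `X ^ m * s` with `s` prime to `X`, and
`1 = a * s + b * X ^ (m + 1)`. Then `b * X ^ (m + 1)`, evaluated at `f`, is an idempotent of trace
zero, hence vanishes. -/
theorem isNilpotent_of_trace_pow_eq_zero {K V : Type*} [Field K] [CharZero K] [AddCommGroup V]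
    [Module K V] [FiniteDimensional K V] {f : Module.End K V}
    (hf : ∀ k : ℕ, LinearMap.trace K V (f ^ (k + 1)) = 0) : IsNilpotent f := by
  obtain ⟨s, hs, hXs⟩ :=
    exists_eq_pow_rootMultiplicity_mul_and_not_dvd f.charpoly f.charpoly_monic.ne_zero 0
  rw [map_zero, sub_zero] at hs hXs
  set m := rootMultiplicity 0 f.charpoly
  have hker : aeval f (X ^ m * s) = 0 := hs ▸ f.aeval_self_charpoly
  obtain ⟨a, b, hab⟩ : IsCoprime s (X ^ (m + 1)) :=
    (irreducible_X.coprime_iff_not_dvd.mpr hXs).symm.pow_right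
  have hidem : IsIdempotentElem (aeval f (b * X ^ (m + 1))) :=
    isIdempotentElem_aeval_of_mul_eq_zero hab <| by
      rw [show a * s * (b * X ^ (m + 1)) = a * b * X * (X ^ m * s) by ring, map_mul, hker, mul_zero]
  have hzero : aeval f (b * X ^ (m + 1)) = 0 :=
    LinearMap.IsIdempotentElem.eq_zero_of_trace_eq_zero hidem <| by
      rw [pow_succ, ← mul_assoc]
      exact trace_aeval_mul_X_eq_zero hf _
  have hone : aeval f (a * s) = 1 := by
    simpa only [map_add, hzero, add_zero, map_one] using congrArg (aeval f) hab
  refine ⟨m, ?_⟩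
  calc f ^ m = aeval f (X ^ m : K[X]) * aeval f (a * s) := by rw [hone, mul_one, aeval_X_pow]
    _ = aeval f (a * (X ^ m * s)) := by rw [← map_mul, mul_left_comm]
    _ = 0 := by rw [map_mul, hker, mul_zero]

end TraceNilpotent

/-! ### Left-symmetric products -/

/-- Left symmetry of a product: its associator is symmetric in the first two arguments. The product
is a bare function so that the notion covers both linear and continuous bilinear maps. -/
def IsLeftSymmetric {V : Type*} [AddCommGroup V] (μ : V → V → V) : Prop :=
  ∀ x y z, μ x (μ y z) - μ (μ x y) z = μ y (μ x z) - μ (μ y x) z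

namespace IsLeftSymmetric

theorem apply_apply_sub {V : Type*} [AddCommGroup V] {μ : V → V → V} (hμ : IsLeftSymmetric μ)
    (x y z : V) : μ x (μ y z) - μ y (μ x z) = μ (μ x y) z - μ (μ y x) z :=
  sub_eq_sub_iff_sub_eq_sub.mp (hμ x y z)

section Trace

variable {R V : Type*} [CommRing R] [AddCommGroup V] [Module R V] {B : V →ₗ[R] V →ₗ[R] V}
  (hB : IsLeftSymmetric fun x y => B x y)

include hB

theorem flip_apply (x z : V) : (B.flip (B x z) : Module.End R V) =
    B.flip z * B.flip x + (B x * B.flip z - B.flip z * B x) := by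
  ext y
  exact (eq_sub_iff_add_eq'.mp (hB x y z)).symm

theorem trace_flip_pow_mul_flip (htr : ∀ x, LinearMap.trace R V (B.flip x) = 0) (v : V) (k : ℕ) :
    ∀ x, LinearMap.trace R V ((B.flip v : Module.End R V) ^ k * B.flip x) = 0 := by
  induction k with
  | zero => simpa only [pow_zero, one_mul] using htr
  | succ k ih =>
    intro x
    have hcomm : LinearMap.trace R V ((B.flip v : Module.End R V) ^ k * (B x * B.flip v)) =
        LinearMap.trace R V ((B.flip v : Module.End R V) ^ k * (B.flip v * B x)) := by
      rw [← mul_assoc, LinearMap.trace_mul_comm, ← mul_assoc, ← mul_assoc, ← pow_succ, ← pow_succ']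
    have hx := ih (B x v)
    rwa [hB.flip_apply, mul_add, mul_sub, map_add, map_sub, hcomm, sub_self, add_zero, ← mul_assoc,
      ← pow_succ] at hx

end Trace

theorem isNilpotent_flip {K V : Type*} [Field K] [CharZero K] [AddCommGroup V] [Module K V]
    [FiniteDimensional K V] {B : V →ₗ[K] V →ₗ[K] V} (hB : IsLeftSymmetric fun x y => B x y)
    (htr : ∀ x, LinearMap.trace K V (B.flip x) = 0) (v : V) :
    IsNilpotent (B.flip v : Module.End K V) :=
  isNilpotent_of_trace_pow_eq_zero fun k => by
    rw [pow_succ]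
    exact hB.trace_flip_pow_mul_flip htr v k v

end IsLeftSymmetric

/-! ### Products intertwined with a Lie module -/

theorem isNilpotent_of_injective_of_intertwining {R M N : Type*} [Semiring R] [AddCommMonoid M]
    [AddCommMonoid N] [Module R M] [Module R N] {f : Module.End R M} {T : Module.End R N}
    {φ : M →ₗ[R] N} (hφ : Function.Injective φ) (h : T ∘ₗ φ = φ ∘ₗ f) (hT : IsNilpotent T) :
    IsNilpotent f := by
  obtain ⟨k, hk⟩ := hT
  refine ⟨k, LinearMap.ext fun x => hφ ?_⟩
  simpa [hk] using (LinearMap.congr_fun (Module.End.commute_pow_left_of_commute h k) x).symm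

theorem isLSA_of_injective_of_map_eq_lie {h M : Type*} [LieRing h] [LieAlgebra ℝ h]
    [AddCommGroup M] [Module ℝ M] [LieRingModule h M] {L : h →ₗ[ℝ] h →ₗ[ℝ] h} {φ : h →ₗ[ℝ] M}
    (hφ : Function.Injective φ)
    (hL : ∀ x y, φ (L x y) = ⁅x, φ y⁆) (htf : ∀ x y, L x y - L y x = ⁅x, y⁆) : IsLSA L where
  left_symm x y z := by
    rw [sub_eq_sub_iff_sub_eq_sub, ← LinearMap.sub_apply, ← map_sub, htf]
    apply hφ
    simp only [map_sub, hL, lie_lie]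
  torsionFree := htf

theorem trace_flip_eq_zero_of_isNilpotent {R h : Type*} [CommRing R] [IsReduced R] [LieRing h]
    [LieAlgebra R h] [LieRing.IsNilpotent h] {L : h →ₗ[R] h →ₗ[R] h}
    (htf : ∀ x y, L x y - L y x = ⁅x, y⁆) {x : h} (hx : IsNilpotent (L x : Module.End R h)) :
    LinearMap.trace R h (L.flip x) = 0 := by
  have hflip : L.flip x = L x - LieAlgebra.ad R h x := by
    ext y
    rw [LinearMap.sub_apply, LieAlgebra.ad_apply, ← htf, sub_sub_cancel, LinearMap.flip_apply]
  have had : IsNilpotent (LieAlgebra.ad R h x) :=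
    LieModule.isNilpotent_toEnd_of_isNilpotent R h h x
  rw [hflip, map_sub, (LinearMap.isNilpotent_trace_of_isNilpotent hx).eq_zero,
    (LinearMap.isNilpotent_trace_of_isNilpotent had).eq_zero, sub_zero]

theorem isNilpotent_toEnd_quotient {R g : Type*} [CommRing R] [LieRing g] [LieAlgebra R g]
    [LieRing.IsNilpotent g] {S : LieSubalgebra R g} (x : S) :
    IsNilpotent (LieModule.toEnd R S (g ⧸ S.toLieSubmodule) x) := by
  have had : IsNilpotent (LieAlgebra.ad R g (x : g)) :=
    LieModule.isNilpotent_toEnd_of_isNilpotent R g g (x : g)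
  have hx : S.toSubmodule ≤ S.toSubmodule.comap (LieAlgebra.ad R g (x : g)) :=
    fun _ hy => S.lie_mem x.2 hy
  exact Module.End.IsNilpotent.mapQ hx had

section InducedConnection

variable {g : Type*} [LieRing g] [LieAlgebra ℝ g] (S : LieSubalgebra ℝ g)

/-- The second fundamental map `z ↦ J z mod S` of a subalgebra `S`. When `S` is totally real it
identifies `S` with a submodule of the `S`-module `g ⧸ S`. -/
def transverseMap (J : g →ₗ[ℝ] g) : S →ₗ[ℝ] g ⧸ S.toLieSubmodule :=
  (LieSubmodule.Quotient.mk' S.toLieSubmodule : g →ₗ[ℝ] g ⧸ S.toLieSubmodule) ∘ₗ J ∘ₗ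
    S.toSubmodule.subtype

variable {S} {J : g →ₗ[ℝ] g} {D : g →ₗ[ℝ] g →ₗ[ℝ] g}

theorem transverseMap_injective (hJS : ∀ z ∈ S, J z ∈ S → z = 0) :
    Function.Injective (transverseMap S J) :=
  (injective_iff_map_eq_zero _).mpr fun z hz =>
    Subtype.ext (hJS z z.2 (LieSubmodule.Quotient.mk_eq_zero'.mp hz))

theorem transverseMap_inducedConnection (htf : ∀ x y, D x y - D y x = ⁅x, y⁆)
    (hJ : ∀ x y, D x (J y) = J (D x y)) (hS : ∀ w, ∀ x ∈ S, D w x ∈ S) (x z : S) :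
    transverseMap S J (inducedConnection S D (fun w _ => hS w) x z) = ⁅x, transverseMap S J z⁆ := by
  refine (Submodule.Quotient.eq _).mpr ?_
  change J (D x z) - ⁅(x : g), J z⁆ ∈ S
  rw [← hJ, ← htf, sub_sub_cancel]
  exact hS _ _ x.2

theorem isLSA_inducedConnection (htf : ∀ x y, D x y - D y x = ⁅x, y⁆)
    (hJ : ∀ x y, D x (J y) = J (D x y)) (hS : ∀ w, ∀ x ∈ S, D w x ∈ S)
    (hJS : ∀ z ∈ S, J z ∈ S → z = 0) : IsLSA (inducedConnection S D fun w _ => hS w) :=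
  isLSA_of_injective_of_map_eq_lie (transverseMap_injective hJS)
    (transverseMap_inducedConnection htf hJ hS) fun x y => Subtype.ext (htf x y)

theorem trace_flip_inducedConnection [LieRing.IsNilpotent g]
    (htf : ∀ x y, D x y - D y x = ⁅x, y⁆) (hJ : ∀ x y, D x (J y) = J (D x y))
    (hS : ∀ w, ∀ x ∈ S, D w x ∈ S) (hJS : ∀ z ∈ S, J z ∈ S → z = 0) (x : S) :
    LinearMap.trace ℝ S ((inducedConnection S D fun w _ => hS w).flip x) = 0 := by
  have : LieRing.IsNilpotent S :=
    Function.Injective.lieAlgebra_isNilpotent (f := S.incl) Subtype.val_injective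
  refine trace_flip_eq_zero_of_isNilpotent (fun y z => Subtype.ext (htf y z)) ?_
  exact isNilpotent_of_injective_of_intertwining (transverseMap_injective hJS)
    (LinearMap.ext fun z => (transverseMap_inducedConnection htf hJ hS x z).symm)
    (isNilpotent_toEnd_quotient x)

end InducedConnection

/-! ### The connection of a complex product structure -/

section ComplexProduct

variable {g : Type*} [LieRing g] [LieAlgebra ℝ g]

theorem IsProductStructure.injective {E : g →ₗ[ℝ] g} (hE : IsProductStructure E) :
    Function.Injective E :=
  Function.Involutive.injective hE.sq

theorem IsComplexStructure.injective {J : g →ₗ[ℝ] g} (hJ : IsComplexStructure J) :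
    Function.Injective J := fun x y h => by
  rw [← neg_inj, ← hJ.sq, h, hJ.sq]

theorem IsProductStructure.apply_lie_add_lie {E : g →ₗ[ℝ] g} (hE : IsProductStructure E)
    (x y : g) : E (⁅E x, y⁆ + ⁅x, E y⁆) = ⁅x, y⁆ + ⁅E x, E y⁆ := by
  rw [sub_eq_iff_eq_add.mp (hE.integrable x y).symm, map_add, hE.sq, hE.sq]

theorem IsComplexStructure.lie_add_lie {J : g →ₗ[ℝ] g} (hJ : IsComplexStructure J) (x y : g) :
    ⁅J x, y⁆ + ⁅x, J y⁆ = J (⁅x, y⁆ - ⁅J x, J y⁆) := by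
  rw [map_sub, eq_sub_iff_add_eq, hJ.integrable x y]

/-- The bilinear map which on the eigenspaces `g₊`, `g₋` of `E` is the Bott connection
`∇_x y = π₋[x, y]` for `x ∈ g₊`, `y ∈ g₋` and `∇_x y = π₊[x, y]` for `x ∈ g₋`, `y ∈ g₊`, and which
vanishes on `g₊ × g₊` and `g₋ × g₋`. -/
noncomputable def bottConnection (E : g →ₗ[ℝ] g) : g →ₗ[ℝ] g →ₗ[ℝ] g :=
  LinearMap.mk₂ ℝ
    (fun x y => (4⁻¹ : ℝ) • (⁅x, y⁆ - ⁅E x, E y⁆ + E ⁅x, E y⁆ - E ⁅E x, y⁆))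
    (fun x x' y => by simp only [map_add, add_lie]; module)
    (fun c x y => by simp only [map_smul, smul_lie]; module)
    (fun x y y' => by simp only [map_add, lie_add]; module)
    (fun c x y => by simp only [map_smul, lie_smul]; module)

/-- The connection of a complex product structure: the Bott connection, extended to
`g₊ × g₊` and `g₋ × g₋` so that `J` becomes parallel. -/
noncomputable def cpConnection (J E : g →ₗ[ℝ] g) : g →ₗ[ℝ] g →ₗ[ℝ] g :=
  bottConnection E - (LinearMap.llcomp ℝ g g g J).comp ((bottConnection E).compl₂ J)

theorem bottConnection_apply (E : g →ₗ[ℝ] g) (x y : g) : bottConnection E x y =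
    (4⁻¹ : ℝ) • (⁅x, y⁆ - ⁅E x, E y⁆ + E ⁅x, E y⁆ - E ⁅E x, y⁆) := rfl

theorem IsProductStructure.bottConnection_apply_E {E : g →ₗ[ℝ] g} (hE : IsProductStructure E)
    (x y : g) : bottConnection E x (E y) = E (bottConnection E x y) := by
  simp only [bottConnection_apply, map_smul, map_add, map_sub, hE.sq]
  module

theorem bottConnection_sub_bottConnection (E : g →ₗ[ℝ] g) (x y : g) :
    bottConnection E x y - bottConnection E y x = (2⁻¹ : ℝ) • (⁅x, y⁆ - ⁅E x, E y⁆) := by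
  simp only [bottConnection_apply, ← lie_skew x y, ← lie_skew x (E y), ← lie_skew (E x) y,
    ← lie_skew (E x) (E y), map_neg]
  module

theorem cpConnection_apply (J E : g →ₗ[ℝ] g) (x y : g) :
    cpConnection J E x y = bottConnection E x y - J (bottConnection E x (J y)) := rfl

namespace IsComplexProductStructure

variable {J E : g →ₗ[ℝ] g} (hJE : IsComplexProductStructure J E)

include hJE

theorem eq_zero_of_apply_comm {z : g} (hz : J (E z) = E (J z)) : z = 0 := by
  have hJEz : J (E z) = 0 := by
    linear_combination (norm := module) (2⁻¹ : ℝ) • (hJE.anticomm z + hz)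
  exact (map_eq_zero_iff E hJE.product.injective).mp
    ((map_eq_zero_iff J hJE.complex.injective).mp hJEz)

theorem eq_zero_of_mem_plus : ∀ z ∈ hJE.product.plus, J z ∈ hJE.product.plus → z = 0 :=
  fun z (hz : E z = z) (hJz : E (J z) = J z) => hJE.eq_zero_of_apply_comm (by rw [hz, hJz])

theorem eq_zero_of_mem_minus : ∀ z ∈ hJE.product.minus, J z ∈ hJE.product.minus → z = 0 :=
  fun z (hz : E z = -z) (hJz : E (J z) = -J z) =>
    hJE.eq_zero_of_apply_comm (by rw [hz, hJz, map_neg])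

theorem eq_zero_of_symmetric_of_parallel {T : g →ₗ[ℝ] g →ₗ[ℝ] g} (hT : ∀ x y, T x y = T y x)
    (hJ : ∀ x y, T x (J y) = J (T x y)) (hE : ∀ x y, T x (E y) = E (T x y)) : T = 0 := by
  ext x y
  refine hJE.eq_zero_of_apply_comm ?_
  calc J (E (T x y)) = T (E x) (J y) := by rw [hJ, hT (E x), hE, hT x]
    _ = E (J (T x y)) := by rw [hT, hE, hT, hJ]

theorem bottConnection_J_sub (x y : g) :
    bottConnection E x (J y) - bottConnection E y (J x) =
      (2⁻¹ : ℝ) • J (⁅x, y⁆ + ⁅E x, E y⁆) := by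
  have hEJ : ∀ z, E (J z) = -J (E z) := fun z => by rw [hJE.anticomm, neg_neg]
  calc bottConnection E x (J y) - bottConnection E y (J x)
      = (4⁻¹ : ℝ) • ((⁅J x, y⁆ + ⁅x, J y⁆) + (⁅J (E x), E y⁆ + ⁅E x, J (E y)⁆) -
          E ((⁅J (E x), y⁆ + ⁅E x, J y⁆) + (⁅J x, E y⁆ + ⁅x, J (E y)⁆))) := by
        simp only [bottConnection_apply, hEJ, ← lie_skew y, ← lie_skew (E y), lie_neg, neg_lie,
          map_neg, map_add]
        module
    _ = (4⁻¹ : ℝ) • J (⁅x, y⁆ - ⁅J x, J y⁆ + (⁅E x, E y⁆ - ⁅E (J x), E (J y)⁆) +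
          (E (⁅E x, y⁆ + ⁅x, E y⁆) + E (⁅E (J x), J y⁆ + ⁅J x, E (J y)⁆))) := by
        simp only [hJE.complex.lie_add_lie, hEJ, map_add, map_sub, map_neg, neg_lie, lie_neg]
        module
    _ = (2⁻¹ : ℝ) • J (⁅x, y⁆ + ⁅E x, E y⁆) := by
        simp only [hJE.product.apply_lie_add_lie, map_add, map_sub]
        module

theorem isCPConnection_cpConnection : IsCPConnection J E (cpConnection J E) where
  torsionFree x y := by
    have h : cpConnection J E x y - cpConnection J E y x =
        (bottConnection E x y - bottConnection E y x) -
          J (bottConnection E x (J y) - bottConnection E y (J x)) := by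
      simp only [cpConnection_apply, map_sub]
      abel
    rw [h, bottConnection_sub_bottConnection, hJE.bottConnection_J_sub, map_smul,
      hJE.complex.sq]
    module
  parallel_J x y := by
    simp only [cpConnection_apply, map_sub, map_neg, hJE.complex.sq]
    abel
  parallel_E x y := by
    simp only [cpConnection_apply, map_sub, map_neg, hJE.product.bottConnection_apply_E,
      hJE.anticomm, neg_neg]

end IsComplexProductStructure

namespace IsCPConnection

variable {J E : g →ₗ[ℝ] g} {D D' : g →ₗ[ℝ] g →ₗ[ℝ] g} (hD : IsCPConnection J E D)

include hD

theorem apply_mem_plus (hE : IsProductStructure E) (w : g) :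
    ∀ x ∈ hE.plus, D w x ∈ hE.plus := fun x hx =>
  (hD.parallel_E w x).symm.trans (congrArg (D w) hx)

theorem apply_mem_minus (hE : IsProductStructure E) (w : g) :
    ∀ x ∈ hE.minus, D w x ∈ hE.minus := fun x hx =>
  (hD.parallel_E w x).symm.trans ((congrArg (D w) hx).trans (map_neg _ _))

theorem unique (hJE : IsComplexProductStructure J E) (hD' : IsCPConnection J E D') : D' = D := by
  refine sub_eq_zero.mp (hJE.eq_zero_of_symmetric_of_parallel (fun x y => ?_) (fun x y => ?_)
    fun x y => ?_)
  · exact sub_eq_sub_iff_sub_eq_sub.mp ((hD'.torsionFree x y).trans (hD.torsionFree x y).symm)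
  · simp only [LinearMap.sub_apply, hD.parallel_J, hD'.parallel_J, map_sub]
  · simp only [LinearMap.sub_apply, hD.parallel_E, hD'.parallel_E, map_sub]

theorem isLSA_plus (hJE : IsComplexProductStructure J E) : IsLSA (hD.plus hJE.product) :=
  isLSA_inducedConnection hD.torsionFree hD.parallel_J (hD.apply_mem_plus hJE.product)
    hJE.eq_zero_of_mem_plus

theorem isLSA_minus (hJE : IsComplexProductStructure J E) : IsLSA (hD.minus hJE.product) :=
  isLSA_inducedConnection hD.torsionFree hD.parallel_J (hD.apply_mem_minus hJE.product)
    hJE.eq_zero_of_mem_minus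

variable [LieRing.IsNilpotent g]

theorem trace_flip_plus (hJE : IsComplexProductStructure J E) (x : hJE.product.plus) :
    LinearMap.trace ℝ _ ((hD.plus hJE.product).flip x) = 0 :=
  trace_flip_inducedConnection hD.torsionFree hD.parallel_J (hD.apply_mem_plus hJE.product)
    hJE.eq_zero_of_mem_plus x

theorem trace_flip_minus (hJE : IsComplexProductStructure J E) (x : hJE.product.minus) :
    LinearMap.trace ℝ _ ((hD.minus hJE.product).flip x) = 0 :=
  trace_flip_inducedConnection hD.torsionFree hD.parallel_J (hD.apply_mem_minus hJE.product)
    hJE.eq_zero_of_mem_minus x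

end IsCPConnection

end ComplexProduct

/-! ### Curves in a Lie group with prescribed logarithmic derivative -/

section LeftLogDeriv

open Set Bundle

variable {E : Type*} [NormedAddCommGroup E] [NormedSpace ℝ E]
  {H : Type*} [TopologicalSpace H] {I : ModelWithCorners ℝ E H}
  {G : Type*} [TopologicalSpace G] [ChartedSpace H G] [Group G]

variable (I) in
/-- The curve `γ` is differentiable at `t` with left logarithmic derivative `γ⁻¹ γ' = v`: its
velocity is the value at `γ t` of the left-invariant vector field of `v`. -/
def HasLeftLogDerivAt (γ : ℝ → G) (v : E) (t : ℝ) : Prop :=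
  HasMFDerivAt 𝓘(ℝ, ℝ) I γ t
    ((1 : ℝ →L[ℝ] ℝ).smulRight (mulInvariantVectorField (I := I) v (γ t)))

variable (I) in
/-- The time-dependent left-invariant vector field of a curve `u` in the Lie algebra, made
autonomous on `G × ℝ`. -/
noncomputable def leftInvariantTimeField (u : ℝ → E) (p : G × ℝ) :
    TangentSpace (I.prod 𝓘(ℝ, ℝ)) p :=
  ((mulInvariantVectorField (I := I) (u p.2) p.1 : E), (1 : ℝ))

theorem hasLeftLogDerivAt_const (a : G) (t : ℝ) : HasLeftLogDerivAt I (fun _ => a) 0 t := by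
  refine (hasMFDerivAt_const a t).congr_mfderiv (ContinuousLinearMap.ext fun r => ?_)
  have hzero : mulInvariantVectorField (I := I) (0 : E) a = 0 :=
    map_zero (mfderiv I I (fun x : G => a * x) (1 : G))
  rw [hzero]
  exact (smul_zero (M := ℝ) (A := E) r).symm

namespace HasLeftLogDerivAt

variable {γ : ℝ → G} {u : ℝ → E} {v : E} {t : ℝ}

theorem velocity_eq (h : HasLeftLogDerivAt I γ v t) :
    velocity (I := I) γ t = leftTranslation (γ t) v := by
  rw [velocity, HasMFDerivAt.mfderiv h]
  exact one_smul (α := E) ℝ _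

theorem hasMFDerivAt_graph (h : HasLeftLogDerivAt I γ (u t) t) :
    HasMFDerivAt 𝓘(ℝ, ℝ) (I.prod 𝓘(ℝ, ℝ)) (fun s => (γ s, s)) t
      ((1 : ℝ →L[ℝ] ℝ).smulRight (leftInvariantTimeField I u (γ t, t))) := by
  refine (HasMFDerivAt.prodMk h (hasMFDerivAt_id t)).congr_mfderiv
    (ContinuousLinearMap.ext fun r => Prod.ext rfl ?_)
  exact (mul_one (M := ℝ) r).symm

end HasLeftLogDerivAt

theorem eqOn_id_of_hasDerivAt_one {f : ℝ → ℝ} {S : Set ℝ} (hS : IsOpen S) (hS' : IsPreconnected S)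
    (hf : ∀ t ∈ S, HasDerivAt f 1 t) {s : ℝ} (hs : s ∈ S) (h : f s = s) : EqOn f id S :=
  hS.eqOn_of_deriv_eq hS' (fun t ht => (hf t ht).differentiableAt.differentiableWithinAt)
    differentiableOn_id (fun t ht => by rw [(hf t ht).deriv, deriv_id]) hs h

theorem hasLeftLogDerivAt_fst_of_hasMFDerivAt {u : ℝ → E} {Γ : ℝ → G × ℝ} {S : Set ℝ}
    (hS : IsOpen S) (hS' : IsPreconnected S)
    (hΓ : ∀ t ∈ S, HasMFDerivAt 𝓘(ℝ, ℝ) (I.prod 𝓘(ℝ, ℝ)) Γ t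
      ((1 : ℝ →L[ℝ] ℝ).smulRight (leftInvariantTimeField I u (Γ t))))
    {s : ℝ} (hs : s ∈ S) (h : (Γ s).2 = s) {t : ℝ} (ht : t ∈ S) :
    HasLeftLogDerivAt I (fun r => (Γ r).1) (u t) t := by
  have hsnd : ∀ r ∈ S, HasDerivAt (fun r => (Γ r).2) 1 r := fun r hr => by
    have hcomp := (hasMFDerivAt_snd (I := I) (I' := 𝓘(ℝ, ℝ)) (Γ r)).comp r (hΓ r hr)
    have hid : HasFDerivAt (fun r => (Γ r).2) (ContinuousLinearMap.id ℝ ℝ) r := by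
      refine (hcomp.congr_mfderiv (ContinuousLinearMap.ext fun c => ?_)).hasFDerivAt
      exact mul_one (M := ℝ) c
    exact hid.hasDerivAt
  have htime : (Γ t).2 = t := eqOn_id_of_hasDerivAt_one hS hS' hsnd hs h ht
  have hfst : HasLeftLogDerivAt I (fun r => (Γ r).1) (u (Γ t).2) t :=
    (hasMFDerivAt_fst (I := I) (I' := 𝓘(ℝ, ℝ)) (Γ t)).comp t (hΓ t ht)
  rwa [htime] at hfst

section MulLeft

variable [ContMDiffMul I 1 G]

theorem mfderiv_mul_left_mulInvariantVectorField (a b : G) (v : GroupLieAlgebra I G) :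
    mfderiv I I (fun x : G => a * x) b (mulInvariantVectorField v b) =
      mulInvariantVectorField v (a * b) := by
  have hcomp : mfderiv I I (fun x : G => a * b * x) 1 =
      mfderiv I I ((fun x : G => a * x) ∘ fun x => b * x) 1 := by
    congr 1
    exact funext fun x => mul_assoc a b x
  rw [mfderiv_comp (I' := I) _ mdifferentiableAt_mul_left mdifferentiableAt_mul_left] at hcomp
  refine Eq.trans ?_ (DFunLike.congr_fun hcomp v).symm
  change _ = mfderiv I I (fun x : G => a * x) (b * 1) _
  rw [mul_one]
  rfl

theorem HasLeftLogDerivAt.mul_left {γ : ℝ → G} {v : E} {t : ℝ} (h : HasLeftLogDerivAt I γ v t)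
    (a : G) : HasLeftLogDerivAt I (fun s => a * γ s) v t := by
  have hmul : MDifferentiableAt I I (fun x : G => a * x) (γ t) := mdifferentiableAt_mul_left
  refine (hmul.hasMFDerivAt.comp t h).congr_mfderiv (ContinuousLinearMap.ext fun r => ?_)
  let c : ℝ := r
  refine (map_smul (mfderiv I I (fun x : G => a * x) (γ t)) c _).trans ?_
  exact congrArg (c • ·) (mfderiv_mul_left_mulInvariantVectorField a (γ t) v)

end MulLeft

variable [LieGroup I ∞ G]

theorem contMDiff_mulInvariantVectorField_comp {F : Type*} [NormedAddCommGroup F] [NormedSpace ℝ F]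
    {K : Type*} [TopologicalSpace K] {J : ModelWithCorners ℝ F K} {N : Type*} [TopologicalSpace N]
    [ChartedSpace K N] {f : N → G} {u : N → E} (hf : ContMDiff J I 1 f)
    (hu : ContMDiff J 𝓘(ℝ, E) 1 u) : ContMDiff J I.tangent 1 (fun p =>
      (⟨f p, mulInvariantVectorField (I := I) (u p) (f p)⟩ : TangentBundle I G)) := by
  have hzero : ContMDiff I I.tangent 1 (fun a : G => (TotalSpace.mk' E a 0 : TangentBundle I G)) :=
    contMDiff_zeroSection _ _
  have hone : ContMDiff J I.tangent 1
      (fun p => (TotalSpace.mk' E (1 : G) (u p) : TangentBundle I G)) := fun p =>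
    contMDiffAt_totalSpace.mpr ⟨contMDiffAt_const, (hu p).congr_of_eventuallyEq
      (.of_forall fun _ => trivializationAt_one_snd rfl _)⟩
  have hprod : ContMDiff (I.tangent.prod I.tangent) (I.prod I).tangent 1
    (equivTangentBundleProd I G I G).symm := contMDiff_equivTangentBundleProd_symm
  have hmul : ContMDiff (I.prod I).tangent I.tangent 1
      (tangentMap (I.prod I) I (fun p : G × G => p.1 * p.2)) :=
    (contMDiff_mul I ∞).contMDiff_tangentMap (by norm_cast)
  convert! (hmul.comp hprod).comp ((hzero.comp hf).prodMk hone) with p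
  · exact (mul_one _).symm
  refine Eq.symm ((mfderiv_prod_eq_add_apply (v := ((0, u p) : E × E))
    ((contMDiff_mul I ∞).mdifferentiable (by simp) ((f p, 1) : G × G))).trans ?_)
  change mfderiv I I (fun z : G => z * 1) (f p) 0 + _ = _
  rw [map_zero, zero_add]
  rfl

theorem contMDiff_leftInvariantTimeField {u : ℝ → E} (hu : ContDiff ℝ 1 u) :
    ContMDiff (I.prod 𝓘(ℝ, ℝ)) (I.prod 𝓘(ℝ, ℝ)).tangent 1 (fun p : G × ℝ =>
      (⟨p, leftInvariantTimeField I u p⟩ : TangentBundle (I.prod 𝓘(ℝ, ℝ)) (G × ℝ))) := by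
  have hspace := contMDiff_mulInvariantVectorField_comp (I := I) (G := G)
    (contMDiff_fst (I := I) (J := 𝓘(ℝ, ℝ)) (N := ℝ)) (hu.contMDiff.comp contMDiff_snd)
  have htime : ContMDiff 𝓘(ℝ, ℝ) 𝓘(ℝ, ℝ).tangent 1
      (fun s : ℝ => (⟨s, (1 : ℝ)⟩ : TangentBundle 𝓘(ℝ, ℝ) ℝ)) := fun s => by
    refine contMDiffAt_totalSpace.mpr ⟨contMDiffAt_id, ?_⟩
    simpa only [mfld_simps] using contMDiffAt_const
  have hprod : ContMDiff (I.tangent.prod 𝓘(ℝ, ℝ).tangent) (I.prod 𝓘(ℝ, ℝ)).tangent 1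
    (equivTangentBundleProd I G 𝓘(ℝ, ℝ) ℝ).symm := contMDiff_equivTangentBundleProd_symm
  exact hprod.comp (hspace.prodMk (htime.comp contMDiff_snd))

theorem exists_hasLeftLogDerivAt_ball [CompleteSpace E] [BoundarylessManifold I G] {u : ℝ → E}
    (hu : ContDiff ℝ 1 u) (s : ℝ) :
    ∃ ε > 0, ∃ γ : ℝ → G, ∀ t ∈ Metric.ball s ε, HasLeftLogDerivAt I γ (u t) t := by
  have : IsManifold I 1 G := IsManifold.of_le (n := ∞) (by norm_cast)
  obtain ⟨Γ, hΓ, hint⟩ := exists_isMIntegralCurveAt_of_contMDiffAt_boundaryless (t₀ := s)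
    ((contMDiff_leftInvariantTimeField (I := I) (G := G) hu).contMDiffAt (x := (1, s)))
  obtain ⟨ε, hε, hball⟩ := Metric.eventually_nhds_iff_ball.mp hint
  exact ⟨ε, hε, fun t => (Γ t).1, fun t ht => hasLeftLogDerivAt_fst_of_hasMFDerivAt
    Metric.isOpen_ball (convex_ball s ε).isPreconnected hball (Metric.mem_ball_self hε)
    (congrArg Prod.snd hΓ) ht⟩

theorem exists_uniform_hasLeftLogDerivAt_ball [CompleteSpace E] [BoundarylessManifold I G]
    {u : ℝ → E} (hu : ContDiff ℝ 1 u) (hc : HasCompactSupport u) :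
    ∃ ε > 0, ∀ s, ∃ γ : ℝ → G, ∀ t ∈ Metric.ball s ε, HasLeftLogDerivAt I γ (u t) t := by
  choose ε hε γ hγ using exists_hasLeftLogDerivAt_ball (I := I) (G := G) hu
  obtain ⟨δ, hδ, hball⟩ := lebesgue_number_lemma_of_metric (c := fun s => Metric.ball s (ε s))
    (hc.cthickening (r := 1)) (fun _ => Metric.isOpen_ball)
    fun s _ => mem_iUnion.mpr ⟨s, Metric.mem_ball_self (hε s)⟩
  refine ⟨min δ 1, lt_min hδ one_pos, fun s => ?_⟩
  by_cases hs : s ∈ Metric.cthickening 1 (tsupport u)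
  · obtain ⟨s', hs'⟩ := hball s hs
    exact ⟨γ s', fun t ht => hγ s' t (hs' (Metric.ball_subset_ball (min_le_left _ _) ht))⟩
  · refine ⟨fun _ => 1, fun t ht => ?_⟩
    have hut : u t = 0 := by
      by_contra hne
      refine hs (Metric.mem_cthickening_of_dist_le s t 1 _ (subset_tsupport u hne) ?_)
      rw [dist_comm]
      exact (ht.trans_le (min_le_right _ _)).le
    exact hut ▸ hasLeftLogDerivAt_const 1 t

/- Left translates of solutions are solutions, so a time of existence that works at one point of
the group works at all of them. -/
theorem exists_hasLeftLogDerivAt_of_hasCompactSupport [CompleteSpace E] [BoundarylessManifold I G]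
    [T2Space G] {u : ℝ → E} (hu : ContDiff ℝ 1 u) (hc : HasCompactSupport u) (a : G) :
    ∃ γ : ℝ → G, γ 0 = a ∧ ∀ t, HasLeftLogDerivAt I γ (u t) t := by
  have : IsManifold I 1 G := IsManifold.of_le (n := ∞) (by norm_cast)
  have : ContMDiffMul I 1 G := ContMDiffMul.of_le (n := ∞) (by norm_cast)
  obtain ⟨ε, hε, hlocal⟩ := exists_uniform_hasLeftLogDerivAt_ball (I := I) (G := G) hu hc
  have hstart (p : G × ℝ) : ∃ Γ : ℝ → G × ℝ, Γ 0 = p ∧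
      IsMIntegralCurveOn Γ (leftInvariantTimeField I u) (Ioo (-ε) ε) := by
    obtain ⟨b, s⟩ := p
    obtain ⟨c, hcurve⟩ := hlocal s
    have hΓ : IsMIntegralCurveOn (fun t => (b * (c s)⁻¹ * c t, t)) (leftInvariantTimeField I u)
        (Metric.ball s ε) := fun t ht =>
      ((hcurve t ht).mul_left _).hasMFDerivAt_graph.hasMFDerivWithinAt
    refine ⟨_, ?_, (hΓ.comp_add s).mono fun t ht => ?_⟩
    · simp
    · rw [mem_ofPred_eq, Metric.mem_ball, Real.dist_eq, add_sub_cancel_right]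
      exact abs_lt.mpr ht
  obtain ⟨Γ, hΓ, hint⟩ := exists_isMIntegralCurve_of_isMIntegralCurveOn
    (contMDiff_leftInvariantTimeField (I := I) (G := G) hu) hε hstart (a, 0)
  exact ⟨fun t => (Γ t).1, congrArg Prod.fst hΓ, fun t => hasLeftLogDerivAt_fst_of_hasMFDerivAt
    isOpen_univ isPreconnected_univ (fun r _ => hint r) (mem_univ 0) (congrArg Prod.snd hΓ)
    (mem_univ t)⟩

theorem exists_hasLeftLogDerivAt [CompleteSpace E] [BoundarylessManifold I G] [T2Space G]
    {u : ℝ → E} (hu : ContDiff ℝ 1 u) (a : G) :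
    ∃ γ : ℝ → G, γ 0 = a ∧ ∀ t, HasLeftLogDerivAt I γ (u t) t := by
  have : IsManifold I 1 G := IsManifold.of_le (n := ∞) (by norm_cast)
  have hIoo (T : ℝ) : ∃ Γ : ℝ → G × ℝ, Γ 0 = (a, 0) ∧
      IsMIntegralCurveOn Γ (leftInvariantTimeField I u) (Ioo (-T) T) := by
    let χ : ContDiffBump (0 : ℝ) := ⟨|T| + 1, |T| + 2, by positivity, by linarith⟩
    obtain ⟨γ, hγ0, hγ⟩ := exists_hasLeftLogDerivAt_of_hasCompactSupport (I := I)
      (χ.contDiff.smul hu) (χ.hasCompactSupport.smul_right (f' := u)) a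
    refine ⟨fun t => (γ t, t), Prod.ext hγ0 rfl, fun t ht => ?_⟩
    have htball : t ∈ Metric.closedBall (0 : ℝ) χ.rIn := by
      rw [mem_closedBall_zero_iff, Real.norm_eq_abs]
      exact (abs_lt.mpr ht).le.trans ((le_abs_self T).trans (lt_add_one |T|).le)
    have hχ : ((χ : ℝ → ℝ) • u) t = u t := by
      rw [Pi.smul_apply', χ.one_of_mem_closedBall htball, one_smul]
    exact HasLeftLogDerivAt.hasMFDerivAt_graph (hχ ▸ hγ t) |>.hasMFDerivWithinAt
  obtain ⟨Γ, hΓ, hint⟩ := (exists_isMIntegralCurve_iff_exists_isMIntegralCurveOn_Ioo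
    (contMDiff_leftInvariantTimeField (I := I) (G := G) hu) (a, 0)).mpr hIoo
  exact ⟨fun t => (Γ t).1, congrArg Prod.fst hΓ, fun t => hasLeftLogDerivAt_fst_of_hasMFDerivAt
    isOpen_univ isPreconnected_univ (fun r _ => hint r) (mem_univ 0) (congrArg Prod.snd hΓ)
    (mem_univ t)⟩

end LeftLogDeriv

/-! ### Linear differential equations in a Banach algebra -/

section LinearODE

open scoped Topology

theorem hasDerivAt_ringInverse_comp {𝕜 R : Type*} [NontriviallyNormedField 𝕜] [NormedRing R]
    [HasSummableGeomSeries R] [NormedAlgebra 𝕜 R] {f : 𝕜 → R} {f' : R} {t : 𝕜}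
    (hf : HasDerivAt f f' t) (hu : IsUnit (f t)) :
    HasDerivAt (fun s => Ring.inverse (f s)) (-(Ring.inverse (f t) * f' * Ring.inverse (f t)))
      t := by
  obtain ⟨a, ha⟩ := hu
  rw [← ha, Ring.inverse_unit]
  exact (ha ▸ hasFDerivAt_ringInverse (𝕜 := 𝕜) a).comp_hasDerivAt t hf

theorem hasDerivAt_units_inv {𝕜 R : Type*} [NontriviallyNormedField 𝕜] [NormedRing R]
    [HasSummableGeomSeries R] [NormedAlgebra 𝕜 R] {C : 𝕜 → Rˣ} {w : R} {t : 𝕜}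
    (hC : HasDerivAt (fun s => (C s : R)) (C t * w) t) :
    HasDerivAt (fun s => ((C s)⁻¹ : Rˣ).val) (-(w * ((C t)⁻¹ : Rˣ).val)) t := by
  have hinv := hasDerivAt_ringInverse_comp hC (C t).isUnit
  simp only [Ring.inverse_unit, Units.inv_mul_cancel_left] at hinv
  exact hinv

variable {R : Type*} [NormedRing R] [CompleteSpace R] [NormedAlgebra ℝ R]

theorem hasMFDerivAt_units_val (a : Rˣ) :
    HasMFDerivAt 𝓘(ℝ, R) 𝓘(ℝ, R) (Units.val : Rˣ → R) a (ContinuousLinearMap.id ℝ R) := by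
  refine ⟨Units.continuous_val.continuousAt, ?_⟩
  have hchart : ∀ᶠ x in 𝓝 (a : R), Units.val ((chartAt R a).symm x) = x := by
    filter_upwards [(chartAt R a).open_target.mem_nhds (mem_chart_target R a)] with x hx
    exact (chartAt R a).right_inv hx
  exact ((hasFDerivAt_id (a : R)).congr_of_eventuallyEq hchart).hasFDerivWithinAt

theorem mulInvariantVectorField_units (a : Rˣ) (w : R) :
    mulInvariantVectorField (I := 𝓘(ℝ, R)) w a = (a : R) * w := by
  have : ContMDiffMul 𝓘(ℝ, R) 1 Rˣ := ContMDiffMul.of_le (n := ∞) (by norm_cast)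
  have hval := (hasMFDerivAt_units_val (a * 1)).comp (1 : Rˣ)
    (mdifferentiableAt_mul_left (I := 𝓘(ℝ, R))).hasMFDerivAt
  have hmul := (((ContinuousLinearMap.mul ℝ R (a : R)).hasFDerivAt
    (x := ((1 : Rˣ) : R))).hasMFDerivAt).comp (1 : Rˣ) (hasMFDerivAt_units_val 1)
  exact DFunLike.congr_fun (hasMFDerivAt_unique hval hmul) w

theorem exists_units_hasDerivAt_mul {w : ℝ → R} (hw : ContDiff ℝ 1 w) :
    ∃ C : ℝ → Rˣ, C 0 = 1 ∧ ∀ t, HasDerivAt (fun t => (C t : R)) (C t * w t) t := by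
  obtain ⟨C, hC0, hC⟩ := exists_hasLeftLogDerivAt (I := 𝓘(ℝ, R)) (G := Rˣ) hw 1
  refine ⟨C, hC0, fun t => ?_⟩
  have hderiv : HasFDerivAt (fun t => (C t : R))
      ((1 : ℝ →L[ℝ] ℝ).smulRight ((C t : R) * w t)) t := by
    rw [← mulInvariantVectorField_units]
    exact ((hasMFDerivAt_units_val (C t)).comp t (hC t)).hasFDerivAt
  simpa using hderiv.hasDerivAt

end LinearODE

/-! ### The geodesic equation of a left-symmetric product -/

section Geodesic

variable {V : Type*} [NormedAddCommGroup V] [NormedSpace ℝ V]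

namespace IsLeftSymmetric

section Algebra

variable {L : V →L[ℝ] V →L[ℝ] V} (hL : IsLeftSymmetric fun x y => L x y)

include hL

theorem clm_apply_commutator (x y : V) : L (L x y - L y x) = L x * L y - L y * L x := by
  ext z
  rw [map_sub]
  exact (hL.apply_apply_sub x y z).symm

theorem clm_flip_apply (x z : V) :
    L.flip (L x z) = L.flip z * L.flip x + (L x * L.flip z - L.flip z * L x) := by
  ext y
  exact (eq_sub_iff_add_eq'.mp (hL x y z)).symm

theorem clm_flip_eq_of_add_smul_apply_eq {v y : V} {t : ℝ} (hy : y + t • L y v = v) :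
    L.flip v = (1 + t • L.flip v) * L.flip y +
      (L y * (1 + t • L.flip v) - (1 + t • L.flip v) * L y) := by
  conv_lhs => rw [← hy, map_add, map_smul, hL.clm_flip_apply]
  simp only [smul_add, smul_sub, mul_add, add_mul, one_mul, mul_one, smul_mul_assoc, mul_smul_comm]
  abel

end Algebra

variable [CompleteSpace V] {L : V →L[ℝ] V →L[ℝ] V} (hL : IsLeftSymmetric fun x y => L x y)

include hL

theorem hasDerivAt_inverse_one_add_smul_flip {v : V} {t : ℝ}
    (ht : IsUnit (1 + t • L.flip v)) :
    let W := fun s : ℝ => Ring.inverse (1 + s • L.flip v)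
    HasDerivAt W ((L (W t v) - L.flip (W t v)) * W t - W t * L (W t v)) t := by
  intro W
  set y := W t v
  have hWM : W t * (1 + t • L.flip v) = 1 := Ring.inverse_mul_cancel _ ht
  have hMW : (1 + t • L.flip v) * W t = 1 := Ring.mul_inverse_cancel _ ht
  have hR := hL.clm_flip_eq_of_add_smul_apply_eq (show y + t • L y v = v from
    DFunLike.congr_fun hMW v)
  have hd : HasDerivAt (fun s : ℝ => 1 + s • L.flip v) (L.flip v) t :=
    (((hasDerivAt_id t).smul_const (L.flip v)).const_add 1).congr_deriv (one_smul ℝ _)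
  refine (hasDerivAt_ringInverse_comp hd ht).congr_deriv ?_
  set M := 1 + t • L.flip v
  calc -(W t * L.flip v * W t)
      = -(W t * (M * L.flip y + (L y * M - M * L y)) * W t) := by rw [← hR]
    _ = -((W t * M) * L.flip y * W t + (W t * L y * (M * W t) - (W t * M) * L y * W t)) := by
        noncomm_ring
    _ = (L y - L.flip y) * W t - W t * L y := by rw [hMW, hWM]; noncomm_ring

/- Since `ad y = L y - L.flip y`, the curve `P` evolves by the adjoint action, and `L` intertwines
the adjoint action with conjugation. -/
theorem units_mul_apply_mul_inv {C : ℝ → (V →L[ℝ] V)ˣ} {P : ℝ → V →L[ℝ] V}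
    {y : ℝ → V} (hC0 : C 0 = 1) (hP0 : P 0 = 1)
    (hC : ∀ t, HasDerivAt (fun s => (C s : V →L[ℝ] V)) (C t * -L (y t)) t)
    (hP : ∀ t, HasDerivAt P ((L (y t) - L.flip (y t)) * P t) t) (t : ℝ) (x : V) :
    (C t : V →L[ℝ] V) * L (P t x) * ((C t)⁻¹ : (V →L[ℝ] V)ˣ).val = L x := by
  have hd (s : ℝ) : HasDerivAt (fun s => (C s : V →L[ℝ] V) * L (P s x) *
      ((C s)⁻¹ : (V →L[ℝ] V)ˣ).val) 0 s := by
    have hPx : HasDerivAt (fun s => P s x) (L (y s) (P s x) - L (P s x) (y s)) s :=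
      ((hP s).clm_apply (hasDerivAt_const s x)).congr_deriv (by simp)
    have hLPx : HasDerivAt (fun s => L (P s x)) (L (y s) * L (P s x) - L (P s x) * L (y s)) s := by
      rw [← hL.clm_apply_commutator]
      exact L.hasFDerivAt.comp_hasDerivAt s hPx
    refine (((hC s).mul hLPx).mul (hasDerivAt_units_inv (hC s))).congr_deriv ?_
    simp only [Pi.mul_apply]
    noncomm_ring
  have hconst := is_const_of_deriv_eq_zero (fun s => (hd s).differentiableAt)
    (fun s => (hd s).deriv) t 0
  rw [hconst, hC0, hP0]
  simp

theorem exists_hasDerivAt_neg_apply_self {v : V} (hv : IsNilpotent (L.flip v)) :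
    ∃ u : ℝ → V, u 0 = v ∧ ∀ t, HasDerivAt u (-L (u t) (u t)) t := by
  have hM (t : ℝ) : IsUnit (1 + t • L.flip v) := (hv.smul t).isUnit_one_add
  let W (t : ℝ) : V →L[ℝ] V := Ring.inverse (1 + t • L.flip v)
  let y (t : ℝ) : V := W t v
  have hWsmooth : ContDiff ℝ 1 W := contDiff_iff_contDiffAt.mpr fun t => by
    obtain ⟨a, ha⟩ := hM t
    have hinv : ContDiffAt ℝ 1 Ring.inverse (1 + t • L.flip v) := ha ▸ contDiffAt_ringInverse ℝ a
    exact hinv.comp t (contDiff_const.add (contDiff_id.smul contDiff_const)).contDiffAt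
  obtain ⟨C, hC0, hC⟩ := exists_units_hasDerivAt_mul (w := fun t => -L (y t))
    (L.contDiff.comp (hWsmooth.clm_apply contDiff_const)).neg
  let P (t : ℝ) : V →L[ℝ] V := W t * ((C t)⁻¹ : (V →L[ℝ] V)ˣ).val
  have hP (t : ℝ) : HasDerivAt P ((L (y t) - L.flip (y t)) * P t) t := by
    refine ((hL.hasDerivAt_inverse_one_add_smul_flip (hM t)).mul
      (hasDerivAt_units_inv (hC t))).congr_deriv ?_
    change ((L (y t) - L.flip (y t)) * W t - W t * L (y t)) * _ + W t * _ = _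
    simp only [P]
    noncomm_ring
  have hP0 : P 0 = 1 := by simp [P, W, hC0]
  refine ⟨fun t => (C t : V →L[ℝ] V) v, by simp [hC0], fun t => ?_⟩
  refine ((hC t).clm_apply (hasDerivAt_const t v)).congr_deriv ?_
  have hCinv : ((C t)⁻¹ : (V →L[ℝ] V)ˣ).val ((C t : V →L[ℝ] V) v) = v :=
    DFunLike.congr_fun (C t).inv_mul v
  have hPu : P t ((C t : V →L[ℝ] V) v) = y t := congrArg (W t) hCinv
  rw [← hL.units_mul_apply_mul_inv hC0 hP0 hC hP t ((C t : V →L[ℝ] V) v), hPu]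
  simp [hCinv]

end IsLeftSymmetric

end Geodesic

theorem contDiff_one_of_hasDerivAt {𝕜 V : Type*} [NontriviallyNormedField 𝕜]
    [NormedAddCommGroup V] [NormedSpace 𝕜 V] {f : V → V} {u : 𝕜 → V} (hf : Continuous f)
    (hu : ∀ t, HasDerivAt u (f (u t)) t) : ContDiff 𝕜 1 u := by
  have hd : Differentiable 𝕜 u := fun t => (hu t).differentiableAt
  have hderiv : deriv u = f ∘ u := funext fun t => (hu t).deriv
  exact contDiff_one_iff_deriv.mpr ⟨hd, hderiv ▸ hf.comp hd.continuous⟩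

section Completeness

variable {V : Type*} [NormedAddCommGroup V] [NormedSpace ℝ V] [FiniteDimensional ℝ V]

theorem IsLeftSymmetric.exists_contDiff_hasDerivAt_neg_apply_self {B : V →ₗ[ℝ] V →ₗ[ℝ] V}
    (hB : IsLeftSymmetric fun x y => B x y) (htr : ∀ x, LinearMap.trace ℝ V (B.flip x) = 0)
    (v : V) :
    ∃ u : ℝ → V, ContDiff ℝ 1 u ∧ u 0 = v ∧ ∀ t, HasDerivAt u (-B (u t) (u t)) t := by
  have : CompleteSpace V := FiniteDimensional.complete ℝ V
  let L : V →L[ℝ] V →L[ℝ] V := B.toContinuousBilinearMap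
  have hL : IsLeftSymmetric fun x y => L x y := hB
  have hnil : IsNilpotent (L.flip v) := by
    obtain ⟨k, hk⟩ := hB.isNilpotent_flip htr v
    refine ⟨k, ContinuousLinearMap.coe_injective ?_⟩
    rw [ContinuousLinearMap.toLinearMap_pow]
    exact hk
  obtain ⟨u, hu0, hu⟩ := hL.exists_hasDerivAt_neg_apply_self hnil
  have hcont : Continuous fun x => -L x x := (L.continuous.clm_apply continuous_id).neg
  exact ⟨u, contDiff_one_of_hasDerivAt hcont hu, hu0, hu⟩

variable {H : Type*} [TopologicalSpace H] {I : ModelWithCorners ℝ V H}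
  {G : Type*} [TopologicalSpace G] [ChartedSpace H G] [Group G] [LieGroup I ∞ G]
  {B : GroupLieAlgebra I G →ₗ[ℝ] GroupLieAlgebra I G →ₗ[ℝ] GroupLieAlgebra I G}

theorem isGeodesic_leftInvariantConnection {γ : ℝ → G} {u : ℝ → V}
    (hγ : ∀ t, HasLeftLogDerivAt I γ (u t) t)
    (hu : ∀ t, HasDerivAt u (-B (u t) (u t)) t) :
    IsGeodesic (leftInvariantConnection B) γ := by
  have hcoord : leftCoordAlong (I := I) γ (velocity γ) = u := funext fun t => by
    rw [leftCoordAlong, (hγ t).velocity_eq]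
    exact maurerCartan_leftTranslation _ _
  refine ⟨fun t => (hγ t).mdifferentiableAt, hcoord ▸ fun t => (hu t).differentiableAt,
    fun t => ?_⟩
  have hconnection : leftInvariantConnection B (mulInvariantVectorField (u t)) (γ t)
      (leftTranslation (γ t) (u t)) = leftTranslation (γ t) (B (u t) (u t)) :=
    leftInvariantConnection_mulInvariantVectorField B (u t) (u t) (γ t)
  have hmc : maurerCartan (I := I) (γ t) (velocity γ t) = u t := congrFun hcoord t
  rw [covDerivAlong, hcoord, (hu t).deriv, hmc, (hγ t).velocity_eq, hconnection, map_neg,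
    neg_add_cancel]

theorem isGeodesicallyComplete_leftInvariantConnection [T2Space G] [BoundarylessManifold I G]
    (hB : IsLeftSymmetric fun x y => B x y)
    (htr : ∀ x, LinearMap.trace ℝ (GroupLieAlgebra I G) (B.flip x) = 0) :
    IsGeodesicallyComplete (leftInvariantConnection B) := by
  have : CompleteSpace V := FiniteDimensional.complete ℝ V
  rintro ⟨a, p⟩
  obtain ⟨u, hsmooth, hu0, hu⟩ :=
    IsLeftSymmetric.exists_contDiff_hasDerivAt_neg_apply_self (V := V) hB htr
      (maurerCartan (I := I) a p)
  obtain ⟨γ, rfl, hγ⟩ := exists_hasLeftLogDerivAt (I := I) (G := G) hsmooth a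
  refine ⟨γ, isGeodesic_leftInvariantConnection hγ hu, ?_⟩
  have hvelocity : velocity (I := I) γ 0 = p := by
    rw [(hγ 0).velocity_eq, hu0]
    exact leftTranslation_maurerCartan _ _
  rw [hvelocity]

end Completeness

theorem IsLSA.isCompleteLSA_of_trace_flip_eq_zero {h : Type u} [LieRing h] [LieAlgebra ℝ h]
    {L : h →ₗ[ℝ] h →ₗ[ℝ] h} (hL : IsLSA L) (htr : ∀ x, LinearMap.trace ℝ h (L.flip x) = 0) :
    IsCompleteLSA.{w} L := by
  intro n G _ _ _ _ _ φ
  have : T1Space G := (𝓡 n).t1Space G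
  have : IsTopologicalGroup G := topologicalGroup_of_lieGroup (𝓡 n) ∞
  refine isGeodesicallyComplete_leftInvariantConnection (fun x y z => ?_) fun x => ?_
  · simpa [transportProduct] using congrArg φ.symm (hL.left_symm (φ x) (φ y) (φ z))
  · have hconj := LinearMap.trace_conj' (L.flip (φ x)) φ.symm.toLinearEquiv
    exact hconj.trans (htr (φ x))

theorem theorem3p3 {g : Type u} [LieRing g] [LieAlgebra ℝ g] [FiniteDimensional ℝ g]
    [LieRing.IsNilpotent g] (J E : g →ₗ[ℝ] g) (hJE : IsComplexProductStructure J E) :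
    ∃ (D : g →ₗ[ℝ] g →ₗ[ℝ] g) (hD : IsCPConnection J E D),
      (∀ D' : g →ₗ[ℝ] g →ₗ[ℝ] g, IsCPConnection J E D' → D' = D) ∧
      (IsLSA (hD.plus hJE.product) ∧ IsCompleteLSA.{w} (hD.plus hJE.product)) ∧
      (IsLSA (hD.minus hJE.product) ∧ IsCompleteLSA.{w} (hD.minus hJE.product)) := by
  have hD := hJE.isCPConnection_cpConnection
  exact ⟨cpConnection J E, hD, fun D' hD' => hD.unique hJE hD',
    ⟨hD.isLSA_plus hJE, (hD.isLSA_plus hJE).isCompleteLSA_of_trace_flip_eq_zero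
      (hD.trace_flip_plus hJE)⟩,
    ⟨hD.isLSA_minus hJE, (hD.isLSA_minus hJE).isCompleteLSA_of_trace_flip_eq_zero
      (hD.trace_flip_minus hJE)⟩⟩
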